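/- Let $K_\nu$ denote the modified Bessel function of the second kind (principal branch), that is, $$K_\nu(x)=\Bigl(\frac{\pi}{2x}\Bigr)^{1/2}W_{0,\nu}(2x),\qquad x\neq 0,\ |\arg x|<\pi,$$ where $W_{k,m}$ is the Whittaker function. Suppose $x\in\mathbb{C}$, $x\ne 0$, $|\arg x|\le \frac{\pi}{2}$, $\nu\in\mathbb{R}$ and $\tau\in\mathbb{R}$ with $\tau\ge 1$. Then $K_\nu(x)\neq 0$ and $$\left|\frac{K_\nu(\tau x)}{K_\nu(x)}\right|^2\le e^{2(1-\tau)\operatorname{Re}x}.$$ -/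

import Mathlib

noncomputable section

/-- Whittaker's integral
`e^{-z/2} z^k / Γ(1/2 + m - k) * ∫₀^∞ e^{-t} t^{m-k-1/2} (1 + t/z)^{m+k-1/2} dt`,
with principal values of all powers. It converges and equals the Whittaker function `W_{k,m}(z)`
whenever `z ≠ 0`, `|arg z| < π` and `Re (1/2 + m - k) > 0`. -/
def whittakerIntegral (k m z : ℂ) : ℂ :=
  Complex.exp (-z / 2) * z ^ k / Complex.Gamma (1 / 2 + m - k) *
    ∫ t in Set.Ioi (0 : ℝ),
      Complex.exp (-(t : ℂ)) * (t : ℂ) ^ (m - k - 1 / 2) * (1 + (t : ℂ) / z) ^ (m + k - 1 / 2)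

/-- The Whittaker function `W_{k,m}(z)` for `Re k < 1/2`, arbitrary complex `m`, and `z ≠ 0` with
`|arg z| < π` (principal branch). It is even in `m`, and the representative of `{m, -m}` with
nonnegative real part is the one for which Whittaker's integral is sure to converge. -/
def whittakerW (k m z : ℂ) : ℂ :=
  if 0 ≤ m.re then whittakerIntegral k m z else whittakerIntegral k (-m) z

/-- The modified Bessel function of the second kind (Macdonald function)
`K_ν(x) = (π / (2 x))^{1/2} W_{0,ν}(2 x)`, for real order `ν` and complex `x ≠ 0` with
`|arg x| < π` (principal branch). -/
def besselK (ν : ℝ) (x : ℂ) : ℂ :=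
  ((Real.pi : ℂ) / (2 * x)) ^ (1 / 2 : ℂ) * whittakerW 0 (ν : ℂ) (2 * x)

end

/-! For `0 < Re x`, `K_ν(x)` is half of `∫ exp (-x cosh u + ν u) du`. Multiplying by the conjugate
and taking a convolution gives, after a contour shift (`integral_exp_neg_add_eq`), a Nicholson-type
formula (`norm_coshIntegral_sq`): up to a constant, `|K_ν(x)|²` is the integral of the positive
quantities `exp (ν w) exp (-S cosh t)` over real `w` and `t`, where `S = productFreq x w`. Since `S`
is homogeneous of degree one under positive scaling of `x` and `S ≥ 2 Re x`, passing to `τ x`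
multiplies each integrand by at most `exp (2 (1 - τ) Re x)`. Since `S` does not decrease when `x` is
replaced by `|x|`, also `|K_ν(|x|)| ≤ |K_ν(x)|`. Both inequalities pass to the imaginary axis by
continuity, and the second keeps `K_ν` away from zero there.

The definition uses Whittaker's integral, so it must be tied to the cosh integral. On the positive
reals a Laplace convolution and a Mehler–Dirichlet integral give proportionality
(`integral_exp_neg_mul_cosh_eq`); the identity theorem extends it to the half-plane. The constant
cancels in the ratio, so only its nonvanishing matters. -/

open MeasureTheory Filter Topology

open scoped ComplexConjugate ENNReal

/-! ### Holomorphic parametric integrals and the identity theorem. -/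

/-- A parametric integral of holomorphic functions that is locally dominated is holomorphic. -/
theorem differentiableOn_integral_of_locally_dominated {α : Type*} [MeasurableSpace α]
    {μ : Measure α} {U : Set ℂ} (hU : IsOpen U) {f : ℂ → α → ℂ}
    (hmeas : ∀ z ∈ U, AEStronglyMeasurable (f z) μ)
    (hdiff : ∀ᵐ t ∂μ, DifferentiableOn ℂ (fun z => f z t) U)
    (hdom : ∀ z₀ ∈ U, ∃ V ∈ 𝓝 z₀, ∃ bound : α → ℝ, Integrable bound μ ∧
      ∀ᵐ t ∂μ, ∀ z ∈ V, ‖f z t‖ ≤ bound t) :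
    DifferentiableOn ℂ (fun z => ∫ t, f z t ∂μ) U := by
  intro z₀ hz₀
  obtain ⟨V, hV, bound, hbound, hfV⟩ := hdom z₀ hz₀
  obtain ⟨ε, hε, hball⟩ := Metric.mem_nhds_iff.1 (Filter.inter_mem hV (hU.mem_nhds hz₀))
  have hUε : ∀ z ∈ Metric.ball z₀ ε, z ∈ U := fun z hz => (hball hz).2
  have hVε : ∀ z ∈ Metric.ball z₀ ε, z ∈ V := fun z hz => (hball hz).1
  have hz₀V : z₀ ∈ V := hVε _ (Metric.mem_ball_self hε)
  have hε2 : 0 < ε / 2 := half_pos hε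
  have hsub : ∀ z ∈ Metric.ball z₀ (ε / 2), Metric.closedBall z (ε / 2 / 2) ⊆ Metric.ball z₀ ε := by
    intro z hz
    apply Metric.closedBall_subset_ball'
    have := Metric.mem_ball.1 hz
    linarith
  -- The derivative is bounded by Cauchy's estimate on circles of radius `ε / 4` centred in the ball
  -- of radius `ε / 2`; these stay inside the ball of radius `ε`.
  have key := hasDerivAt_integral_of_dominated_loc_of_deriv_le (μ := μ) (F := f) (x₀ := z₀)
    (F' := fun z t => deriv (fun z => f z t) z) (bound := fun t => bound t / (ε / 2 / 2))
    (s := Metric.ball z₀ (ε / 2)) (Metric.ball_mem_nhds _ hε2) ?_ ?_ ?_ ?_ ?_ ?_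
  · exact key.2.differentiableAt.differentiableWithinAt
  · filter_upwards [hU.mem_nhds hz₀] with z hz using hmeas z hz
  · refine hbound.mono' (hmeas z₀ hz₀) ?_
    filter_upwards [hfV] with t ht using ht z₀ hz₀V
  -- The derivative at `z₀` is measurable in `t` as a limit of difference quotients along a
  -- sequence.
  · obtain ⟨w, hw⟩ : ∃ w : ℕ → ℂ, (∀ n, w n ∈ U) ∧ Tendsto w atTop (𝓝[≠] z₀) := by
      have hne : {z | z ∈ U} ∈ 𝓝[≠] z₀ := mem_nhdsWithin_of_mem_nhds (hU.mem_nhds hz₀)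
      obtain ⟨w, hw⟩ := Filter.exists_seq_tendsto (𝓝[≠] z₀)
      obtain ⟨N, hN⟩ := Filter.eventually_atTop.1 (hw.eventually hne)
      exact ⟨fun n => w (n + N), fun n => hN _ (by omega), (tendsto_add_atTop_iff_nat N).2 hw⟩
    refine aestronglyMeasurable_of_tendsto_ae atTop
      (f := fun n t => (w n - z₀)⁻¹ • (f (w n) t - f z₀ t))
      (fun n => ?_) ?_
    · exact ((hmeas _ (hw.1 n)).sub (hmeas _ hz₀)).const_smul (w n - z₀)⁻¹
    filter_upwards [hdiff] with t ht
    exact (hasDerivAt_iff_tendsto_slope.1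
      ((ht z₀ hz₀).differentiableAt (hU.mem_nhds hz₀)).hasDerivAt).comp hw.2
  · filter_upwards [hdiff, hfV] with t ht htV z hz
    refine Complex.norm_deriv_le_of_forall_mem_sphere_norm_le (by positivity) ?_ ?_
    · refine DifferentiableOn.diffContOnCl_ball (U := U) ht ?_
      exact (hsub z hz).trans fun z hz => hUε z hz
    · exact fun y hy => htV y (hVε y (hsub z hz (Metric.sphere_subset_closedBall hy)))
  · exact hbound.div_const _
  · filter_upwards [hdiff] with t ht z hz
    have hzU : z ∈ U := hUε z (hsub z hz (Metric.mem_closedBall_self (by positivity)))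
    exact ((ht z hzU).differentiableAt (hU.mem_nhds hzU)).hasDerivAt

theorem isOpen_re_pos : IsOpen {z : ℂ | 0 < z.re} :=
  isOpen_lt continuous_const Complex.continuous_re

/-- Holomorphic functions on the right half-plane that agree on the positive reals are equal. -/
theorem eq_of_eq_on_pos_reals {f g : ℂ → ℂ} (hf : DifferentiableOn ℂ f {z | 0 < z.re})
    (hg : DifferentiableOn ℂ g {z | 0 < z.re}) (h : ∀ x : ℝ, 0 < x → f x = g x) {z : ℂ}
    (hz : 0 < z.re) : f z = g z := by
  refine AnalyticOnNhd.eqOn_of_preconnected_of_frequently_eq (z₀ := 1)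
    (hf.analyticOnNhd isOpen_re_pos) (hg.analyticOnNhd isOpen_re_pos)
    (convex_halfSpace_re_gt 0).isPreconnected (by simp) ?_ hz
  have htend : Tendsto (fun n : ℕ => ((1 + 1 / ((n : ℝ) + 1) : ℝ) : ℂ)) atTop (𝓝[≠] 1) := by
    refine tendsto_nhdsWithin_iff.2 ⟨?_, Eventually.of_forall fun n => ?_⟩
    · have := (tendsto_one_div_add_atTop_nhds_zero_nat (𝕜 := ℝ)).const_add 1
      rw [add_zero] at this
      simpa [Function.comp_def] using (Complex.continuous_ofReal.tendsto 1).comp this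
    · have : (1 + 1 / ((n : ℝ) + 1) : ℝ) ≠ 1 := by
        have : 0 < 1 / ((n : ℝ) + 1) := by positivity
        linarith
      simpa only [Set.mem_compl_iff, Set.mem_singleton_iff, Complex.ofReal_eq_one] using this
  exact htend.frequently (Frequently.of_forall fun n => h _ (by positivity))

/-! ### The cosh integral on the right half-plane. -/

theorem Real.one_add_sq_div_two_le_cosh (u : ℝ) : 1 + u ^ 2 / 2 ≤ Real.cosh u := by
  have h1 : Real.cosh u = 1 + 2 * Real.sinh (u / 2) ^ 2 := by
    have := Real.cosh_two_mul (u / 2)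
    have h2 := Real.cosh_sq (u / 2)
    rw [mul_div_cancel₀ u two_ne_zero] at this
    linarith
  have h2 : (u / 2) ^ 2 ≤ Real.sinh (u / 2) ^ 2 := by
    rw [← sq_abs, ← sq_abs (Real.sinh _), Real.abs_sinh]
    have := Real.self_le_sinh_iff.2 (abs_nonneg (u / 2))
    gcongr
  nlinarith

theorem integrable_exp_neg_mul_cosh_add {X : ℝ} (hX : 0 < X) (ν : ℝ) :
    Integrable fun u : ℝ => Real.exp (-X * Real.cosh u + ν * u) := by
  -- Of the Gaussian decay `exp (-X u² / 2)` given by the bound on `cosh`, half absorbs the linear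
  -- term `ν u` and half remains.
  refine ((integrable_exp_neg_mul_sq (b := X / 4) (by positivity)).const_mul
    (Real.exp (ν ^ 2 / X))).mono' (by fun_prop) (Eventually.of_forall fun u => ?_)
  rw [Real.norm_eq_abs, Real.abs_exp, ← Real.exp_add]
  refine Real.exp_le_exp.2 ?_
  have h1 := mul_le_mul_of_nonneg_left (Real.one_add_sq_div_two_le_cosh u) hX.le
  have h2 : ν * u ≤ ν ^ 2 / X + X / 4 * u ^ 2 := by
    have h3 : ν ^ 2 / X + X / 4 * u ^ 2 - ν * u = (ν - X / 2 * u) ^ 2 / X := by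
      field_simp; ring
    have : 0 ≤ (ν - X / 2 * u) ^ 2 / X := by positivity
    linarith
  nlinarith

/-- The integral `∫ exp (-x cosh u + ν u) du = 2 K_ν(x)`, for `0 < Re x`. -/
noncomputable def coshIntegral (ν : ℝ) (x : ℂ) : ℂ :=
  ∫ u : ℝ, Complex.exp (-x * (Real.cosh u : ℂ) + (ν * u : ℝ))

theorem norm_exp_neg_mul_cosh_add (ν : ℝ) (x : ℂ) (u : ℝ) :
    ‖Complex.exp (-x * (Real.cosh u : ℂ) + (ν * u : ℝ))‖ =
      Real.exp (-x.re * Real.cosh u + ν * u) := by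
  rw [Complex.norm_exp]
  simp only [Complex.add_re, Complex.re_mul_ofReal, Complex.neg_re, Complex.ofReal_re]

theorem integrable_coshIntegral (ν : ℝ) {x : ℂ} (hx : 0 < x.re) :
    Integrable fun u : ℝ => Complex.exp (-x * (Real.cosh u : ℂ) + (ν * u : ℝ)) := by
  refine (integrable_exp_neg_mul_cosh_add hx ν).mono' ?_ (Eventually.of_forall fun u =>
    (norm_exp_neg_mul_cosh_add ν x u).le)
  refine Continuous.aestronglyMeasurable ?_
  fun_prop

theorem exists_re_gt_nhds {z₀ : ℂ} (hz₀ : 0 < z₀.re) : {z : ℂ | z₀.re / 2 < z.re} ∈ 𝓝 z₀ :=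
  (isOpen_lt continuous_const Complex.continuous_re).mem_nhds (by simpa using hz₀)

theorem differentiableOn_coshIntegral (ν : ℝ) :
    DifferentiableOn ℂ (coshIntegral ν) {z | 0 < z.re} := by
  refine differentiableOn_integral_of_locally_dominated isOpen_re_pos
    (fun z hz => (integrable_coshIntegral ν hz).aestronglyMeasurable)
    (Eventually.of_forall fun t => by fun_prop) fun z₀ hz₀ => ?_
  refine ⟨_, exists_re_gt_nhds hz₀, _, integrable_exp_neg_mul_cosh_add (half_pos hz₀) ν,
    Eventually.of_forall fun t z hz => ?_⟩
  rw [norm_exp_neg_mul_cosh_add]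
  have h1 := Real.cosh_pos t
  have h2 : z₀.re / 2 < z.re := hz
  gcongr

/-! ### Contour shift and product formula. -/

/-- Supplies the locally uniform domination for the contour shift; the summand `0 * t` makes the
bound the `ν = 0` case of `integrable_exp_neg_mul_cosh_add`. -/
theorem exp_add_neg_re_bound {δ : ℝ} {α β : ℂ} (hα : δ ≤ α.re) (hβ : δ ≤ β.re) (t : ℝ) :
    ‖Complex.exp (-(α * (Real.exp t : ℂ) + β * (Real.exp (-t) : ℂ)))‖ ≤
      Real.exp (-(2 * δ) * Real.cosh t + 0 * t) := by
  rw [Complex.norm_exp, Complex.neg_re, Complex.add_re, Complex.re_mul_ofReal,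
    Complex.re_mul_ofReal, Real.cosh_eq]
  refine Real.exp_le_exp.2 ?_
  have h1 := mul_le_mul_of_nonneg_right hα (Real.exp_pos t).le
  have h2 := mul_le_mul_of_nonneg_right hβ (Real.exp_pos (-t)).le
  linarith

theorem div_re_pos {s : ℝ} (hs : 0 < s) {z : ℂ} (hz : 0 < z.re) : 0 < ((s : ℂ) / z).re := by
  have hz0 : z ≠ 0 := by rintro rfl; simp at hz
  rw [div_eq_mul_inv, Complex.re_ofReal_mul, Complex.inv_re]
  have := Complex.normSq_pos.2 hz0
  positivity

theorem ne_zero_of_re_pos {z : ℂ} (hz : 0 < z.re) : z ≠ 0 := by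
  rintro rfl; simp at hz

/-- The integral of `exp (-(α eᵗ + β e⁻ᵗ))` depends only on the product `α β`. -/
theorem integral_exp_neg_add_eq {α β : ℂ} {s : ℝ} (hs : 0 < s) (hα : 0 < α.re)
    (hαβ : α * β = (s ^ 2 : ℝ)) :
    ∫ t : ℝ, Complex.exp (-(α * (Real.exp t : ℂ) + β * (Real.exp (-t) : ℂ))) =
      ((∫ t : ℝ, Real.exp (-(2 * s) * Real.cosh t) : ℝ) : ℂ) := by
  have hs2 : 0 < s ^ 2 := by positivity
  obtain rfl : β = (s ^ 2 : ℝ) / α := by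
    rw [eq_div_iff (ne_zero_of_re_pos hα), mul_comm, hαβ]
  -- With `β = s² / α`, the integral is holomorphic in `α`, as `β` also stays in the right
  -- half-plane; so positive real `α` suffices.
  refine eq_of_eq_on_pos_reals
    (f := fun α => ∫ t : ℝ, Complex.exp (-(α * (Real.exp t : ℂ) +
      ((s ^ 2 : ℝ) : ℂ) / α * (Real.exp (-t) : ℂ))))
    (g := fun _ => ((∫ t : ℝ, Real.exp (-(2 * s) * Real.cosh t) : ℝ) : ℂ))
    ?_ (differentiableOn_const _) ?_ hα
  · refine differentiableOn_integral_of_locally_dominated isOpen_re_pos ?_ ?_ ?_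
    · intro z hz
      refine Continuous.aestronglyMeasurable ?_
      fun_prop
    · refine Eventually.of_forall fun t z hz => DifferentiableAt.differentiableWithinAt ?_
      have := ne_zero_of_re_pos hz
      fun_prop (disch := assumption)
    · intro z₀ hz₀
      have hcont : ContinuousAt (fun z : ℂ => (((s ^ 2 : ℝ) : ℂ) / z)) z₀ := by
        have := ne_zero_of_re_pos hz₀
        fun_prop (disch := assumption)
      have hq := div_re_pos hs2 hz₀
      have hδ : 0 < min (z₀.re / 2) ((((s ^ 2 : ℝ) : ℂ) / z₀).re / 2) :=
        lt_min (half_pos hz₀) (half_pos hq)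
      refine ⟨_, Filter.inter_mem (exists_re_gt_nhds hz₀) (hcont (exists_re_gt_nhds hq)), _,
        integrable_exp_neg_mul_cosh_add (mul_pos two_pos hδ) 0,
        Eventually.of_forall fun t z hz => exp_add_neg_re_bound ?_ ?_ t⟩
      · exact (min_le_left _ _).trans hz.1.le
      · exact (min_le_right _ _).trans (le_of_lt hz.2)
  · intro x hx
    -- Translating by `log (x / s)` balances the two coefficients: both become `s`.
    rw [← integral_complex_ofReal, ← integral_sub_right_eq_self _ (Real.log (x / s))]
    congr 1
    ext t
    have h1 : Real.exp (t - Real.log (x / s)) = Real.exp t * (s / x) := by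
      rw [Real.exp_sub, Real.exp_log (by positivity)]; field_simp
    have h2 : Real.exp (-(t - Real.log (x / s))) = Real.exp (-t) * (x / s) := by
      rw [neg_sub, Real.exp_sub, Real.exp_log (by positivity), Real.exp_neg]; field_simp
    rw [h1, h2, Real.cosh_eq, Complex.ofReal_exp (_ * _)]
    congr 1
    have : (x : ℂ) ≠ 0 := by exact_mod_cast hx.ne'
    have : (s : ℂ) ≠ 0 := by exact_mod_cast hs.ne'
    push_cast
    field_simp

/-- The frequency in the product formula `norm_coshIntegral_sq`. -/
noncomputable def productFreq (x : ℂ) (w : ℝ) : ℝ :=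
  √(4 * x.re ^ 2 + 2 * ‖x‖ ^ 2 * (Real.cosh w - 1))

theorem productFreq_radicand_nonneg (x : ℂ) (w : ℝ) :
    0 ≤ 2 * ‖x‖ ^ 2 * (Real.cosh w - 1) :=
  mul_nonneg (by positivity) (sub_nonneg.2 (Real.one_le_cosh w))

theorem two_re_le_productFreq (x : ℂ) (w : ℝ) : 2 * x.re ≤ productFreq x w := by
  refine Real.le_sqrt_of_sq_le ?_
  have := productFreq_radicand_nonneg x w
  nlinarith

theorem productFreq_ofReal_mul {τ : ℝ} (hτ : 0 ≤ τ) (x : ℂ) (w : ℝ) :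
    productFreq (τ * x) w = τ * productFreq x w := by
  rw [productFreq, productFreq, Complex.re_ofReal_mul, norm_mul, Complex.norm_real,
    Real.norm_of_nonneg hτ, ← Real.sqrt_sq hτ, ← Real.sqrt_mul (sq_nonneg _), Real.sqrt_sq hτ]
  congr 1
  ring

theorem productFreq_le_norm (x : ℂ) (w : ℝ) : productFreq x w ≤ productFreq (‖x‖ : ℝ) w := by
  refine Real.sqrt_le_sqrt ?_
  rw [Complex.ofReal_re, Complex.norm_real, norm_norm]
  have := Complex.abs_re_le_norm x
  have : x.re ^ 2 ≤ ‖x‖ ^ 2 := by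
    rw [← sq_abs]; gcongr
  linarith

theorem conj_coshIntegral (ν : ℝ) (x : ℂ) :
    coshIntegral ν (conj x) = conj (coshIntegral ν x) := by
  rw [coshIntegral, coshIntegral, ← integral_conj]
  congr 1
  ext u
  rw [← Complex.exp_conj, map_add, map_mul, map_neg, Complex.conj_ofReal, Complex.conj_ofReal]

/-- The linear terms combine to `ν w`, and the rest of the exponent is `-(α eᵗ + β e⁻ᵗ)` with `α =
(x + x̄ e⁻ʷ) / 2` and `β = (x + x̄ eʷ) / 2`. Their product is real, equal to `(productFreq x w /
2)²`, so the contour shift applies. -/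
theorem convolution_exp_neg_mul_cosh (ν : ℝ) {x : ℂ} (hx : 0 < x.re) (w : ℝ) :
    convolution (fun u : ℝ => Complex.exp (-x * (Real.cosh u : ℂ) + (ν * u : ℝ)))
      (fun u : ℝ => Complex.exp (-(conj x) * (Real.cosh u : ℂ) + (ν * u : ℝ)))
      (ContinuousLinearMap.mul ℂ ℂ) volume w =
    ((Real.exp (ν * w) * ∫ t, Real.exp (-productFreq x w * Real.cosh t) : ℝ) : ℂ) := by
  have hS : 0 < productFreq x w := by linarith [two_re_le_productFreq x w]
  have hα : 0 < ((x + conj x * (Real.exp (-w) : ℂ)) / 2).re := by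
    rw [Complex.div_ofNat_re, Complex.add_re, Complex.re_mul_ofReal, Complex.conj_re]
    positivity
  have hS2 : productFreq x w ^ 2 = 4 * x.re ^ 2 + 2 * ‖x‖ ^ 2 * (Real.cosh w - 1) :=
    Real.sq_sqrt (by have := productFreq_radicand_nonneg x w; positivity)
  have hαβ : ((x + conj x * (Real.exp (-w) : ℂ)) / 2) * ((x + conj x * (Real.exp w : ℂ)) / 2) =
      (((productFreq x w / 2) ^ 2 : ℝ) : ℂ) := by
    rw [div_pow, hS2, Complex.sq_norm, Complex.normSq_apply, Real.cosh_eq]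
    have h1 : Real.exp (-w) * Real.exp w = 1 := by rw [← Real.exp_add]; simp
    apply Complex.ext
    · simp only [Complex.mul_re, Complex.div_ofNat_re, Complex.div_ofNat_im, Complex.add_re,
        Complex.add_im, Complex.mul_im, Complex.conj_re, Complex.conj_im, Complex.ofReal_re,
        Complex.ofReal_im]
      linear_combination ((x.re * x.re - x.im * x.im) / 4) * h1
    · simp only [Complex.mul_re, Complex.div_ofNat_re, Complex.div_ofNat_im, Complex.add_re,
        Complex.add_im, Complex.mul_im, Complex.conj_re, Complex.conj_im, Complex.ofReal_re,
        Complex.ofReal_im]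
      linear_combination (-(x.re * x.im) / 2) * h1
  have key := integral_exp_neg_add_eq (half_pos hS) hα hαβ
  rw [mul_div_cancel₀ _ two_ne_zero] at key
  rw [convolution_def, Complex.ofReal_mul, ← key, ← integral_const_mul]
  congr 1
  ext t
  rw [ContinuousLinearMap.mul_apply', ← Complex.exp_add, Complex.ofReal_exp, ← Complex.exp_add]
  congr 1
  rw [Real.cosh_eq, Real.cosh_eq, neg_sub, Real.exp_sub, Real.exp_sub, Real.exp_neg, Real.exp_neg]
  have h1 : (Real.exp w : ℂ) ≠ 0 := by exact_mod_cast (Real.exp_pos w).ne'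
  have h2 : (Real.exp t : ℂ) ≠ 0 := by exact_mod_cast (Real.exp_pos t).ne'
  push_cast at h1 h2 ⊢
  field_simp
  ring

/-- Inherited from the convolution of two integrable functions, so the inner integral needs no
estimate as `w` varies. -/
theorem integrable_productFormula (ν : ℝ) {x : ℂ} (hx : 0 < x.re) :
    Integrable fun w => Real.exp (ν * w) * ∫ t, Real.exp (-productFreq x w * Real.cosh t) := by
  have hx' : 0 < (conj x).re := by rwa [Complex.conj_re]
  have h := (integrable_coshIntegral ν hx).integrable_convolution (ContinuousLinearMap.mul ℂ ℂ)
    (integrable_coshIntegral ν hx')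
  have h2 : Integrable fun w =>
      ((Real.exp (ν * w) * ∫ t, Real.exp (-productFreq x w * Real.cosh t) : ℝ) : ℂ) :=
    h.congr (Eventually.of_forall fun w => convolution_exp_neg_mul_cosh ν hx w)
  exact h2.re

/-- A product formula of Nicholson type for `|K_ν(x)|²`. -/
theorem norm_coshIntegral_sq (ν : ℝ) {x : ℂ} (hx : 0 < x.re) :
    ‖coshIntegral ν x‖ ^ 2 =
      ∫ w, Real.exp (ν * w) * ∫ t, Real.exp (-productFreq x w * Real.cosh t) := by
  have hx' : 0 < (conj x).re := by rwa [Complex.conj_re]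
  have h := integral_convolution (μ := volume) (ν := volume) (ContinuousLinearMap.mul ℂ ℂ)
    (integrable_coshIntegral ν hx) (integrable_coshIntegral ν hx')
  rw [integral_congr_ae (Eventually.of_forall fun w => convolution_exp_neg_mul_cosh ν hx w),
    integral_complex_ofReal, ContinuousLinearMap.mul_apply'] at h
  have h2 : coshIntegral ν x * conj (coshIntegral ν x) = coshIntegral ν x * coshIntegral ν (conj x) := by
    rw [conj_coshIntegral]
  rw [Complex.mul_conj, Complex.normSq_eq_norm_sq] at h2
  exact_mod_cast h2.trans h.symm

/-! ### Inequalities drawn from the product formula. -/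

theorem integrable_exp_neg_mul_cosh {s : ℝ} (hs : 0 < s) :
    Integrable fun t => Real.exp (-s * Real.cosh t) := by
  simpa using integrable_exp_neg_mul_cosh_add hs 0

theorem productFreq_pos {x : ℂ} (hx : 0 < x.re) (w : ℝ) : 0 < productFreq x w := by
  linarith [two_re_le_productFreq x w]

theorem norm_coshIntegral_pos (ν : ℝ) {x : ℂ} (hx : 0 < x.re) : 0 < ‖coshIntegral ν x‖ := by
  have hpos : ∀ w, 0 < Real.exp (ν * w) * ∫ t, Real.exp (-productFreq x w * Real.cosh t) :=
    fun w => mul_pos (Real.exp_pos _)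
      (integral_exp_pos (integrable_exp_neg_mul_cosh (productFreq_pos hx w)))
  have h : 0 < ‖coshIntegral ν x‖ ^ 2 := by
    rw [norm_coshIntegral_sq ν hx, integral_pos_iff_support_of_nonneg (fun w => (hpos w).le)
      (integrable_productFormula ν hx), Function.support_eq_univ fun w => (hpos w).ne']
    simp
  exact (norm_nonneg _).lt_of_ne' fun h0 => by simp [h0] at h

/-- A larger frequency gives a smaller integrand. This lower bound survives the limit to the
imaginary axis, where nonvanishing on the open half-plane alone would say nothing. -/
theorem norm_coshIntegral_norm_le (ν : ℝ) {x : ℂ} (hx : 0 < x.re) :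
    ‖coshIntegral ν (‖x‖ : ℝ)‖ ≤ ‖coshIntegral ν x‖ := by
  have hn : 0 < ((‖x‖ : ℝ) : ℂ).re := by
    rw [Complex.ofReal_re]; exact norm_pos_iff.2 (ne_zero_of_re_pos hx)
  refine (pow_le_pow_iff_left₀ (norm_nonneg _) (norm_nonneg _) two_ne_zero).1 ?_
  rw [norm_coshIntegral_sq ν hx, norm_coshIntegral_sq ν hn]
  refine integral_mono (integrable_productFormula ν hn) (integrable_productFormula ν hx) fun w => ?_
  refine mul_le_mul_of_nonneg_left (integral_mono
    (integrable_exp_neg_mul_cosh (productFreq_pos hn w))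
    (integrable_exp_neg_mul_cosh (productFreq_pos hx w)) fun t => ?_) (Real.exp_pos _).le
  have h1 := productFreq_le_norm x w
  have h2 := Real.cosh_pos t
  simp only
  gcongr

/-- By homogeneity the exponent drops by `(τ - 1) S cosh t`, with `S = productFreq x w`, and this is
at least `(τ - 1) (2 Re x)` for all `w` and `t`. -/
theorem norm_coshIntegral_mul_le (ν : ℝ) {x : ℂ} (hx : 0 < x.re) {τ : ℝ} (hτ : 1 ≤ τ) :
    ‖coshIntegral ν (τ * x)‖ ^ 2 ≤
      Real.exp ((1 - τ) * (2 * x.re)) * ‖coshIntegral ν x‖ ^ 2 := by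
  have hτ0 : 0 < τ := by linarith
  have hx' : 0 < ((τ : ℂ) * x).re := by rw [Complex.re_ofReal_mul]; positivity
  rw [norm_coshIntegral_sq ν hx, norm_coshIntegral_sq ν hx', ← integral_const_mul]
  refine integral_mono (integrable_productFormula ν hx')
    ((integrable_productFormula ν hx).const_mul _) fun w => ?_
  simp only
  rw [mul_left_comm, ← integral_const_mul (Real.exp ((1 - τ) * (2 * x.re)))]
  refine mul_le_mul_of_nonneg_left (integral_mono
    (integrable_exp_neg_mul_cosh (productFreq_pos hx' w))
    ((integrable_exp_neg_mul_cosh (productFreq_pos hx w)).const_mul _) fun t => ?_)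
    (Real.exp_pos _).le
  simp only
  rw [← Real.exp_add, productFreq_ofReal_mul hτ0.le]
  refine Real.exp_le_exp.2 ?_
  have h1 := two_re_le_productFreq x w
  have h2 : 2 * x.re ≤ productFreq x w * Real.cosh t :=
    h1.trans (le_mul_of_one_le_right (productFreq_pos hx w).le (Real.one_le_cosh t))
  nlinarith [mul_nonneg (sub_nonneg.2 hτ) (sub_nonneg.2 h2)]

/-! ### Equivalence of the two real integral representations. -/

theorem lintegral_eq_mul_lintegral_comp_mul {q : ℝ} (hq : q ≠ 0) (g : ℝ → ℝ≥0∞) :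
    ∫⁻ w, g w = ENNReal.ofReal |q| * ∫⁻ y, g (q * y) := by
  have h := lintegral_image_eq_lintegral_abs_deriv_mul (s := Set.univ) (f := fun y => q * y)
    (f' := fun _ => q) MeasurableSet.univ
    (fun y _ => (hasDerivAt_const_mul q).hasDerivWithinAt)
    (mul_right_injective₀ hq).injOn g
  rw [Set.image_univ, (mul_left_surjective₀ hq).range_eq, setLIntegral_univ, setLIntegral_univ,
    lintegral_const_mul' _ _ ENNReal.ofReal_ne_top] at h
  exact h

/-- The truncated power `s₊ ^ (ν - 1)`. -/
noncomputable def truncPow (ν s : ℝ) : ℝ≥0∞ :=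
  if 0 < s then ENNReal.ofReal (s ^ (ν - 1)) else 0

theorem measurable_truncPow (ν : ℝ) : Measurable (truncPow ν) := by
  unfold truncPow
  exact Measurable.ite measurableSet_Ioi (by fun_prop) measurable_const

theorem truncPow_of_nonpos {ν s : ℝ} (hs : s ≤ 0) : truncPow ν s = 0 := if_neg hs.not_gt

theorem truncPow_mul {a : ℝ} (ha : 0 < a) (ν s : ℝ) :
    truncPow ν (a * s) = ENNReal.ofReal (a ^ (ν - 1)) * truncPow ν s := by
  rcases le_or_gt s 0 with hs | hs
  · rw [truncPow_of_nonpos hs, mul_zero, truncPow_of_nonpos (by nlinarith)]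
  · rw [truncPow, truncPow, if_pos hs, if_pos (by positivity), Real.mul_rpow ha.le hs.le,
      ENNReal.ofReal_mul (by positivity)]

/-- The Mehler–Dirichlet type integral behind the equivalence of the two integral representations
of the Macdonald function. -/
theorem lintegral_exp_mul_truncPow (ν : ℝ) {t : ℝ} (ht : 1 < t) :
    ∫⁻ u, ENNReal.ofReal (Real.exp (ν * u)) * truncPow ν (t - Real.cosh u) =
      ENNReal.ofReal (2 ^ (1 - ν) * (t ^ 2 - 1) ^ (ν - 1 / 2)) *
        ∫⁻ y, truncPow ν (1 - y ^ 2) := by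
  have hq2 : 0 < t ^ 2 - 1 := by nlinarith
  set q := √(t ^ 2 - 1) with hq
  have hqpos : 0 < q := Real.sqrt_pos.2 hq2
  have hqsq : q ^ 2 = t ^ 2 - 1 := Real.sq_sqrt hq2.le
  -- Substituting `w = eᵘ` turns `t - cosh u` into a quadratic in `w`. Completing the square gives
  -- `q² - (w - t)²`, and rescaling by `q` isolates the dependence on `t`.
  have himage := lintegral_image_eq_lintegral_abs_deriv_mul (s := Set.univ) (f := Real.exp)
    (f' := Real.exp) MeasurableSet.univ (fun y _ => (Real.hasDerivAt_exp y).hasDerivWithinAt)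
    Real.exp_injective.injOn
    (fun w => ENNReal.ofReal (2 ^ (1 - ν)) * truncPow ν (2 * t * w - w ^ 2 - 1))
  rw [Set.image_univ, Real.range_exp, setLIntegral_univ] at himage
  have h1 : ∀ u, ENNReal.ofReal |Real.exp u| * (ENNReal.ofReal (2 ^ (1 - ν)) *
      truncPow ν (2 * t * Real.exp u - Real.exp u ^ 2 - 1)) =
      ENNReal.ofReal (Real.exp (ν * u)) * truncPow ν (t - Real.cosh u) := by
    intro u
    have hu : 2 * t * Real.exp u - Real.exp u ^ 2 - 1 = (2 * Real.exp u) * (t - Real.cosh u) := by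
      rw [Real.cosh_eq, Real.exp_neg]
      field_simp
      ring
    rw [hu, truncPow_mul (by positivity), ← mul_assoc, ← mul_assoc,
      ← ENNReal.ofReal_mul (by positivity), ← ENNReal.ofReal_mul (by positivity), abs_of_pos
      (Real.exp_pos u), Real.mul_rpow two_pos.le (Real.exp_pos u).le, ← Real.exp_mul]
    congr 2
    have h2 : (2 : ℝ) ^ (1 - ν) * 2 ^ (ν - 1) = 1 := by
      rw [← Real.rpow_add two_pos]; simp
    calc _ = (2 : ℝ) ^ (1 - ν) * 2 ^ (ν - 1) * (Real.exp u * Real.exp (u * (ν - 1))) := by ring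
      _ = _ := by rw [h2, one_mul, ← Real.exp_add]; ring_nf
  -- The quadratic is negative for `w ≤ 0`, so the truncation makes the extension to the whole line
  -- free.
  have h2 : ∫⁻ w in Set.Ioi 0, ENNReal.ofReal (2 ^ (1 - ν)) * truncPow ν (2 * t * w - w ^ 2 - 1) =
      ∫⁻ w, ENNReal.ofReal (2 ^ (1 - ν)) * truncPow ν (2 * t * w - w ^ 2 - 1) := by
    refine setLIntegral_eq_of_support_subset ?_
    intro w hw
    by_contra hw0
    refine hw ?_
    have hw1 : w ≤ 0 := not_lt.1 hw0
    simp only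
    rw [truncPow_of_nonpos (by nlinarith), mul_zero]
  have h3 : ∫⁻ w, truncPow ν (2 * t * w - w ^ 2 - 1) = ∫⁻ w, truncPow ν (q ^ 2 - w ^ 2) := by
    rw [← lintegral_add_right_eq_self _ t]
    congr 1
    ext w
    rw [hqsq]
    congr 1
    ring
  rw [← lintegral_congr h1, ← himage, h2, lintegral_const_mul' _ _ ENNReal.ofReal_ne_top, h3,
    lintegral_eq_mul_lintegral_comp_mul hqpos.ne']
  have h4 : ∀ y, truncPow ν (q ^ 2 - (q * y) ^ 2) =
      ENNReal.ofReal ((q ^ 2) ^ (ν - 1)) * truncPow ν (1 - y ^ 2) := by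
    intro y
    rw [← truncPow_mul (by positivity)]
    congr 1
    ring
  rw [lintegral_congr h4, lintegral_const_mul' _ _ ENNReal.ofReal_ne_top, ← mul_assoc, ← mul_assoc,
    ← ENNReal.ofReal_mul (by positivity), ← ENNReal.ofReal_mul (by positivity), abs_of_pos hqpos,
    mul_assoc, hqsq, hq, Real.sqrt_eq_rpow, ← Real.rpow_add hq2]
  ring_nf

/-- Tonelli after the shift `t = s + cosh u`: the product of Laplace transforms becomes the
transform of a convolution, which the Mehler–Dirichlet integral evaluates. Lower integrals avoid all
integrability conditions. -/
theorem lintegral_exp_mul_lintegral_truncPow (ν x : ℝ) :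
    (∫⁻ u, ENNReal.ofReal (Real.exp (-x * Real.cosh u + ν * u))) *
        (∫⁻ s, truncPow ν s * ENNReal.ofReal (Real.exp (-x * s))) =
      (ENNReal.ofReal (2 ^ (1 - ν)) * ∫⁻ y, truncPow ν (1 - y ^ 2)) *
        ∫⁻ t in Set.Ioi 1, ENNReal.ofReal (Real.exp (-x * t) * (t ^ 2 - 1) ^ (ν - 1 / 2)) := by
  have hm := measurable_truncPow ν
  rw [← lintegral_mul_const _ (by fun_prop), ← lintegral_const_mul _ (by fun_prop)]
  have h1 : ∀ u, ENNReal.ofReal (Real.exp (-x * Real.cosh u + ν * u)) *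
      (∫⁻ s, truncPow ν s * ENNReal.ofReal (Real.exp (-x * s))) =
      ∫⁻ t, ENNReal.ofReal (Real.exp (-x * t)) *
        (ENNReal.ofReal (Real.exp (ν * u)) * truncPow ν (t - Real.cosh u)) := by
    intro u
    rw [← lintegral_sub_right_eq_self _ (Real.cosh u),
      ← lintegral_const_mul' _ _ ENNReal.ofReal_ne_top]
    congr 1
    ext t
    rw [mul_left_comm, ← ENNReal.ofReal_mul (Real.exp_pos _).le, ← Real.exp_add, ← mul_assoc,
      ← ENNReal.ofReal_mul (Real.exp_pos _).le, ← Real.exp_add, mul_comm]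
    ring_nf
  rw [lintegral_congr h1, lintegral_lintegral_swap (by fun_prop)]
  rw [← lintegral_indicator measurableSet_Ioi]
  congr 1
  ext t
  rw [lintegral_const_mul' _ _ ENNReal.ofReal_ne_top]
  by_cases ht : 1 < t
  · rw [Set.indicator_of_mem (by exact ht), lintegral_exp_mul_truncPow ν ht,
      ENNReal.ofReal_mul (by positivity), ENNReal.ofReal_mul (by positivity)]
    ring
  · rw [Set.indicator_of_notMem (by exact ht)]
    have h0 : ∀ u, truncPow ν (t - Real.cosh u) = 0 := fun u =>
      truncPow_of_nonpos (by linarith [Real.one_le_cosh u])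
    simp [h0]

/-- For `ν > 0` the Laplace transform of the truncated power is `Γ(ν) x^(-ν)`, which can be divided
out. -/
theorem integral_exp_neg_mul_cosh_eq_pos {ν : ℝ} (hν : 0 < ν) : ∃ c : ℝ, c ≠ 0 ∧ ∀ x : ℝ, 0 < x →
    x ^ ν * ∫ t in Set.Ioi (1 : ℝ), Real.exp (-x * t) * (t ^ 2 - 1) ^ (ν - 1 / 2) =
      c * ∫ u, Real.exp (-x * Real.cosh u + ν * u) := by
  set b := (ENNReal.ofReal (2 ^ (1 - ν)) * ∫⁻ y, truncPow ν (1 - y ^ 2)).toReal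
  have key : ∀ x : ℝ, 0 < x → (∫ u, Real.exp (-x * Real.cosh u + ν * u)) *
      ((1 / x) ^ ν * Real.Gamma ν) =
      b * ∫ t in Set.Ioi (1 : ℝ), Real.exp (-x * t) * (t ^ 2 - 1) ^ (ν - 1 / 2) := by
    intro x hx
    have h := congrArg ENNReal.toReal (lintegral_exp_mul_lintegral_truncPow ν x)
    rw [ENNReal.toReal_mul, ENNReal.toReal_mul] at h
    rw [← Real.integral_rpow_mul_exp_neg_mul_Ioi hν hx, integral_eq_lintegral_of_nonneg_ae,
      integral_eq_lintegral_of_nonneg_ae, integral_eq_lintegral_of_nonneg_ae]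
    · refine Eq.trans ?_ h
      congr 2
      rw [← lintegral_indicator measurableSet_Ioi]
      congr 1
      ext s
      by_cases hs : 0 < s
      · rw [Set.indicator_of_mem (by exact hs), truncPow, if_pos hs,
          ENNReal.ofReal_mul (by positivity), neg_mul]
      · rw [Set.indicator_of_notMem (by exact hs), truncPow, if_neg hs, zero_mul]
    · filter_upwards [ae_restrict_mem measurableSet_Ioi] with t ht
      have : 0 < t ^ 2 - 1 := by nlinarith [Set.mem_Ioi.1 ht]
      simp only [Pi.zero_apply]; positivity
    · refine Measurable.aestronglyMeasurable ?_
      fun_prop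
    · filter_upwards [ae_restrict_mem measurableSet_Ioi] with t ht
      have : 0 < t := ht
      simp only [Pi.zero_apply]; positivity
    · refine Measurable.aestronglyMeasurable ?_
      fun_prop
    · exact Eventually.of_forall fun u => (Real.exp_pos _).le
    · refine Continuous.aestronglyMeasurable ?_
      fun_prop
  have hΓ := Real.Gamma_pos_of_pos hν
  -- `toReal` sends both `0` and `∞` to `0`; positivity of the left side at `x = 1` excludes both.
  have hb : b ≠ 0 := by
    intro hb
    have h := key 1 one_pos
    rw [hb, zero_mul] at h
    have := integral_exp_pos (integrable_exp_neg_mul_cosh_add one_pos ν)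
    have h2 : 0 < (∫ u, Real.exp (-1 * Real.cosh u + ν * u)) * ((1 / 1) ^ ν * Real.Gamma ν) := by
      positivity
    exact h2.ne' h
  refine ⟨Real.Gamma ν / b, by positivity, fun x hx => ?_⟩
  have h := key x hx
  rw [Real.div_rpow one_pos.le hx.le, Real.one_rpow] at h
  have hxν : 0 < x ^ ν := by positivity
  field_simp at h ⊢
  linarith

theorem image_cosh_Ioi : Real.cosh '' Set.Ioi 0 = Set.Ioi 1 := by
  ext t
  constructor
  · rintro ⟨u, hu, rfl⟩
    exact Real.one_lt_cosh.2 (ne_of_gt hu)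
  · intro ht
    exact ⟨Real.arcosh t, Real.arcosh_pos ht, Real.cosh_arcosh (le_of_lt ht)⟩

/-- Order zero is separate because `s⁻¹` is not integrable at `0`; here `t = cosh u` and evenness
suffice. -/
theorem integral_exp_neg_mul_cosh_eq_zero (x : ℝ) :
    2 * ∫ t in Set.Ioi (1 : ℝ), Real.exp (-x * t) * (t ^ 2 - 1) ^ (-(1 / 2) : ℝ) =
      ∫ u, Real.exp (-x * Real.cosh u) := by
  rw [← image_cosh_Ioi, integral_image_eq_integral_abs_deriv_smul measurableSet_Ioi
    (fun u _ => (Real.hasDerivAt_cosh u).hasDerivWithinAt)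
    (Real.cosh_strictMonoOn.injOn.mono Set.Ioi_subset_Ici_self)]
  have h := integral_comp_abs (f := fun u => Real.exp (-x * Real.cosh u))
  simp only [Real.cosh_abs] at h
  rw [h]
  congr 1
  refine setIntegral_congr_fun measurableSet_Ioi fun u hu => ?_
  have hs : 0 < Real.sinh u := Real.sinh_pos_iff.2 hu
  simp only [smul_eq_mul]
  rw [← Real.sinh_sq, abs_of_pos hs, Real.rpow_neg (by positivity), ← Real.sqrt_eq_rpow,
    Real.sqrt_sq hs.le]
  field_simp

theorem integral_exp_neg_mul_cosh_eq {ν : ℝ} (hν : 0 ≤ ν) : ∃ c : ℝ, c ≠ 0 ∧ ∀ x : ℝ, 0 < x →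
    x ^ ν * ∫ t in Set.Ioi (1 : ℝ), Real.exp (-x * t) * (t ^ 2 - 1) ^ (ν - 1 / 2) =
      c * ∫ u, Real.exp (-x * Real.cosh u + ν * u) := by
  rcases hν.eq_or_lt with rfl | hν
  · refine ⟨1 / 2, by norm_num, fun x _ => ?_⟩
    simp only [zero_sub, Real.rpow_zero, zero_mul, add_zero, one_mul,
      ← integral_exp_neg_mul_cosh_eq_zero x]
    ring
  · exact integral_exp_neg_mul_cosh_eq_pos hν

/-! ### Regularity of Whittaker's integral and of `besselK` up to the imaginary axis. -/

/-- The integrand of Whittaker's integral for `W_{0,μ+1/2}`. -/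
noncomputable def whittakerKernel (μ : ℝ) (z : ℂ) (t : ℝ) : ℂ :=
  Complex.exp (-(t : ℂ)) * (t : ℂ) ^ (μ : ℂ) * (1 + (t : ℂ) / z) ^ (μ : ℂ)

theorem besselK_eq_integral_whittakerKernel {ν : ℝ} (hν : 0 ≤ ν) (x : ℂ) :
    besselK ν x = ((Real.pi : ℂ) / (2 * x)) ^ (1 / 2 : ℂ) * (Complex.exp (-x) /
      Complex.Gamma (1 / 2 + ν) * ∫ t in Set.Ioi (0 : ℝ), whittakerKernel (ν - 1 / 2) (2 * x) t) := by
  rw [besselK, whittakerW, if_pos (by simpa using hν), whittakerIntegral, Complex.cpow_zero,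
    sub_zero, mul_one, ← mul_neg, mul_div_cancel_left₀ _ two_ne_zero]
  simp only [whittakerKernel]
  push_cast
  simp only [sub_zero, add_zero]

theorem besselK_abs (ν : ℝ) (x : ℂ) : besselK |ν| x = besselK ν x := by
  rcases le_or_gt 0 ν with h | h
  · rw [abs_of_nonneg h]
  · rw [abs_of_neg h, besselK, besselK, whittakerW, whittakerW, if_pos (by simpa using h.le),
      if_neg (by simpa using h), Complex.ofReal_neg]

/-- This keeps the base of the power off the branch cut, and its modulus at least one, so that the
exponent `μ` may be replaced by `|μ|` in upper bounds. -/
theorem one_le_re_one_add_div {z : ℂ} (hz : 0 ≤ z.re) {t : ℝ} (ht : 0 ≤ t) :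
    1 ≤ (1 + (t : ℂ) / z).re := by
  rw [Complex.add_re, Complex.one_re, div_eq_mul_inv, Complex.re_ofReal_mul, Complex.inv_re]
  have := Complex.normSq_nonneg z
  have : 0 ≤ t * (z.re / Complex.normSq z) := by positivity
  linarith

/-- The bound involves `z` only through a lower bound for `|z|`, hence is uniform up to the
imaginary axis away from `0`. -/
theorem norm_whittakerKernel_le (μ : ℝ) {δ : ℝ} (hδ : 0 < δ) {z : ℂ} (hz : 0 ≤ z.re)
    (hδz : δ ≤ ‖z‖) {t : ℝ} (ht : 0 < t) :
    ‖whittakerKernel μ z t‖ ≤ Real.exp (-t) * t ^ μ * (1 + t / δ) ^ |μ| := by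
  rw [whittakerKernel, norm_mul, norm_mul, Complex.norm_cpow_real, Complex.norm_cpow_real,
    Complex.norm_exp, Complex.norm_real, Real.norm_of_nonneg ht.le, Complex.neg_re,
    Complex.ofReal_re]
  refine mul_le_mul_of_nonneg_left ?_ (by positivity)
  have h1 : 1 ≤ ‖1 + (t : ℂ) / z‖ :=
    (one_le_re_one_add_div hz ht.le).trans (Complex.re_le_norm _)
  have h2 : ‖1 + (t : ℂ) / z‖ ≤ 1 + t / δ := by
    refine (norm_add_le _ _).trans ?_
    rw [norm_one, norm_div, Complex.norm_real, Real.norm_of_nonneg ht.le]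
    gcongr
  calc ‖1 + (t : ℂ) / z‖ ^ μ ≤ ‖1 + (t : ℂ) / z‖ ^ |μ| :=
        Real.rpow_le_rpow_of_exponent_le h1 (le_abs_self μ)
    _ ≤ (1 + t / δ) ^ |μ| := Real.rpow_le_rpow (by positivity) h2 (abs_nonneg μ)

theorem one_add_rpow_le {p s : ℝ} (hp : 0 ≤ p) (hs : 0 ≤ s) :
    (1 + s) ^ p ≤ 2 ^ p * (1 + s ^ p) := by
  have hsp : 0 ≤ s ^ p := by positivity
  have h2p : (0 : ℝ) < 2 ^ p := by positivity
  rcases le_total s 1 with h | h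
  · calc (1 + s) ^ p ≤ 2 ^ p := Real.rpow_le_rpow (by positivity) (by linarith) hp
      _ ≤ 2 ^ p * (1 + s ^ p) := le_mul_of_one_le_right h2p.le (by linarith)
  · calc (1 + s) ^ p ≤ (2 * s) ^ p := Real.rpow_le_rpow (by positivity) (by linarith) hp
      _ = 2 ^ p * s ^ p := Real.mul_rpow two_pos.le hs
      _ ≤ 2 ^ p * (1 + s ^ p) := by gcongr; linarith

/-- Splitting the last factor leaves two Gamma integrals, with powers `μ` and `μ + |μ|` of `t`. -/
theorem integrableOn_whittakerKernel_bound {μ δ : ℝ} (hμ : -1 < μ) (hδ : 0 < δ) :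
    IntegrableOn (fun t : ℝ => Real.exp (-t) * t ^ μ * (1 + t / δ) ^ |μ|) (Set.Ioi 0) := by
  have hμ1 : 0 < μ + 1 := by linarith
  have h1 := Real.GammaIntegral_convergent hμ1
  have h2 := Real.GammaIntegral_convergent (s := μ + |μ| + 1) (by linarith [abs_nonneg μ])
  refine ((h1.add (h2.const_mul (1 / δ ^ |μ|))).const_mul (2 ^ |μ|)).mono' ?_ ?_
  · refine Measurable.aestronglyMeasurable ?_
    fun_prop
  · filter_upwards [ae_restrict_mem measurableSet_Ioi] with t ht
    have ht : 0 < t := ht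
    rw [Real.norm_of_nonneg (by positivity)]
    calc Real.exp (-t) * t ^ μ * (1 + t / δ) ^ |μ|
        ≤ Real.exp (-t) * t ^ μ * (2 ^ |μ| * (1 + (t / δ) ^ |μ|)) := by
          gcongr
          exact one_add_rpow_le (abs_nonneg μ) (by positivity)
      _ = _ := by
          simp only [Pi.add_apply, add_sub_cancel_right]
          rw [Real.rpow_add ht, Real.div_rpow ht.le hδ.le]
          ring

theorem measurable_whittakerKernel (μ : ℝ) (z : ℂ) : Measurable (whittakerKernel μ z) := by
  unfold whittakerKernel
  fun_prop

theorem one_add_div_mem_slitPlane {z : ℂ} (hz : 0 ≤ z.re) {t : ℝ} (ht : 0 ≤ t) :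
    1 + (t : ℂ) / z ∈ Complex.slitPlane :=
  Or.inl (one_pos.trans_le (one_le_re_one_add_div hz ht))

theorem differentiableAt_whittakerKernel (μ : ℝ) {z : ℂ} (hz0 : z ≠ 0) (hz : 0 ≤ z.re) {t : ℝ}
    (ht : 0 ≤ t) : DifferentiableAt ℂ (fun z => whittakerKernel μ z t) z := by
  have h := one_add_div_mem_slitPlane hz ht
  unfold whittakerKernel
  refine DifferentiableAt.const_mul (DifferentiableAt.cpow_const (f := fun z => 1 + (t : ℂ) / z) ?_ h) _
  fun_prop (disch := assumption)

theorem half_norm_lt_nhds {z₀ : ℂ} (hz₀ : z₀ ≠ 0) : {z : ℂ | ‖z₀‖ / 2 < ‖z‖} ∈ 𝓝 z₀ :=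
  (isOpen_lt continuous_const continuous_norm).mem_nhds (by simpa using hz₀)

theorem differentiableOn_integral_whittakerKernel {μ : ℝ} (hμ : -1 < μ) :
    DifferentiableOn ℂ (fun z => ∫ t in Set.Ioi (0 : ℝ), whittakerKernel μ z t)
      {z | 0 < z.re} := by
  refine differentiableOn_integral_of_locally_dominated isOpen_re_pos
    (fun z _ => (measurable_whittakerKernel μ z).aestronglyMeasurable) ?_ fun z₀ hz₀ => ?_
  · filter_upwards [ae_restrict_mem measurableSet_Ioi] with t ht z hz
    exact (differentiableAt_whittakerKernel μ (ne_zero_of_re_pos hz) (le_of_lt hz)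
      (le_of_lt ht)).differentiableWithinAt
  · have hz₀' := ne_zero_of_re_pos hz₀
    have hδ : 0 < ‖z₀‖ / 2 := half_pos (norm_pos_iff.2 hz₀')
    refine ⟨_, inter_mem (half_norm_lt_nhds hz₀') (isOpen_re_pos.mem_nhds hz₀), _,
      integrableOn_whittakerKernel_bound hμ hδ, ?_⟩
    filter_upwards [ae_restrict_mem measurableSet_Ioi] with t ht z hz
    exact norm_whittakerKernel_le μ hδ (le_of_lt hz.2) (le_of_lt hz.1) ht

theorem continuousWithinAt_integral_whittakerKernel {μ : ℝ} (hμ : -1 < μ) {z₀ : ℂ} (hz₀ : z₀ ≠ 0)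
    (hre : 0 ≤ z₀.re) :
    ContinuousWithinAt (fun z => ∫ t in Set.Ioi (0 : ℝ), whittakerKernel μ z t)
      {z | 0 ≤ z.re} z₀ := by
  have hδ : 0 < ‖z₀‖ / 2 := half_pos (norm_pos_iff.2 hz₀)
  refine continuousWithinAt_of_dominated
    (Eventually.of_forall fun z => (measurable_whittakerKernel μ z).aestronglyMeasurable) ?_
    (integrableOn_whittakerKernel_bound hμ hδ) ?_
  · filter_upwards [self_mem_nhdsWithin, mem_nhdsWithin_of_mem_nhds (half_norm_lt_nhds hz₀)]
      with z hz hz'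
    filter_upwards [ae_restrict_mem measurableSet_Ioi] with t ht
    exact norm_whittakerKernel_le μ hδ hz (le_of_lt hz') ht
  · filter_upwards [ae_restrict_mem measurableSet_Ioi] with t ht
    exact (differentiableAt_whittakerKernel μ hz₀ hre (le_of_lt ht)).continuousAt.continuousWithinAt

/-- Inversion preserves the closed right half-plane minus `0`, so the principal square root in
`besselK` is regular there. -/
theorem pi_div_mem_slitPlane {x : ℂ} (hx : x ≠ 0) (hre : 0 ≤ x.re) :
    (Real.pi : ℂ) / (2 * x) ∈ Complex.slitPlane := by
  have h : (Real.pi : ℂ) / (2 * x) = ((Real.pi / 2 : ℝ) : ℂ) * x⁻¹ := by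
    push_cast; field_simp
  have hn := Complex.normSq_pos.2 hx
  rw [h, Complex.mem_slitPlane_iff, Complex.re_ofReal_mul, Complex.im_ofReal_mul, Complex.inv_re,
    Complex.inv_im]
  rcases hre.eq_or_lt with h0 | h0
  · right
    have : x.im ≠ 0 := fun him => hx (Complex.ext h0.symm him)
    have := Real.pi_pos
    have : -x.im ≠ 0 := by simpa
    positivity
  · left
    have := Real.pi_pos
    positivity

theorem differentiableOn_besselK {ν : ℝ} (hν : 0 ≤ ν) :
    DifferentiableOn ℂ (besselK ν) {x | 0 < x.re} := by
  have hmaps : Set.MapsTo (fun x : ℂ => 2 * x) {x | 0 < x.re} {x | 0 < x.re} := by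
    intro x hx
    have : 0 < x.re := hx
    simpa using this
  have h := (differentiableOn_integral_whittakerKernel (μ := ν - 1 / 2) (by linarith)).comp
    (differentiableOn_id.const_mul (2 : ℂ)) hmaps
  rw [funext (besselK_eq_integral_whittakerKernel hν)]
  refine DifferentiableOn.mul (fun x hx => ?_) (DifferentiableOn.mul (by fun_prop) h)
  refine DifferentiableAt.differentiableWithinAt ?_
  have hx0 := ne_zero_of_re_pos hx
  refine DifferentiableAt.cpow_const ?_ (pi_div_mem_slitPlane hx0 (le_of_lt hx))
  have : 2 * x ≠ 0 := by simpa
  fun_prop (disch := assumption)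

theorem continuousWithinAt_besselK (ν : ℝ) {x : ℂ} (hx : x ≠ 0) (hre : 0 ≤ x.re) :
    ContinuousWithinAt (besselK ν) {x | 0 ≤ x.re} x := by
  rw [← funext (besselK_abs ν), funext (besselK_eq_integral_whittakerKernel (abs_nonneg ν))]
  have h2x : 2 * x ≠ 0 := by simpa
  have hmaps : Set.MapsTo (fun x : ℂ => 2 * x) {x | 0 ≤ x.re} {x | 0 ≤ x.re} := by
    intro x hx
    have : 0 ≤ x.re := hx
    simpa using this
  have h := (continuousWithinAt_integral_whittakerKernel (μ := |ν| - 1 / 2)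
    (by linarith [abs_nonneg ν]) h2x (hmaps hre)).comp
    (continuous_const.mul continuous_id).continuousWithinAt hmaps
  refine ContinuousWithinAt.mul ?_ (ContinuousWithinAt.mul ?_ h)
  · refine ContinuousAt.continuousWithinAt ?_
    refine ContinuousAt.cpow ?_ continuousAt_const (pi_div_mem_slitPlane hx hre)
    fun_prop (disch := assumption)
  · exact Continuous.continuousWithinAt (by fun_prop)

/-! ### Identification of `besselK` with the cosh integral. -/

/-- Under `t = x (s - 1)` the factor `1 + t / (2 x)` becomes `(s + 1) / 2`, and the two powers merge
into a power of `s² - 1`. -/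
theorem integral_whittakerKernel_ofReal (μ : ℝ) {x : ℝ} (hx : 0 < x) :
    ∫ t in Set.Ioi (0 : ℝ), whittakerKernel μ (2 * (x : ℂ)) t =
      ((x * Real.exp x * (x / 2) ^ μ *
        ∫ t in Set.Ioi (1 : ℝ), Real.exp (-x * t) * (t ^ 2 - 1) ^ μ : ℝ) : ℂ) := by
  have himage : (fun s : ℝ => x * (s - 1)) '' Set.Ioi 1 = Set.Ioi 0 := by
    ext t
    constructor
    · rintro ⟨s, hs, rfl⟩
      exact mul_pos hx (sub_pos.2 hs)
    · intro ht
      refine ⟨t / x + 1, ?_, by field_simp; ring⟩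
      have : 0 < t / x := div_pos ht hx
      simpa using this
  rw [← himage, integral_image_eq_integral_abs_deriv_smul (f' := fun _ => x) measurableSet_Ioi
    (fun s _ => by simpa using (((hasDerivAt_id' s).sub_const 1).const_mul x).hasDerivWithinAt)
    (fun a _ b _ h => by simpa [hx.ne'] using h), ← integral_const_mul, ← integral_complex_ofReal]
  refine setIntegral_congr_fun measurableSet_Ioi fun s hs => ?_
  have hs1 : 0 < s - 1 := sub_pos.2 hs
  have hs2 : 0 < s + 1 := by linarith
  have h1 : (1 : ℂ) + ((x * (s - 1) : ℝ) : ℂ) / (2 * (x : ℂ)) = (((s + 1) / 2 : ℝ) : ℂ) := by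
    have : (x : ℂ) ≠ 0 := by exact_mod_cast hx.ne'
    push_cast
    field_simp
    ring
  simp only [whittakerKernel]
  rw [h1, ← Complex.ofReal_cpow (by positivity), ← Complex.ofReal_cpow (by positivity),
    ← Complex.ofReal_neg, ← Complex.ofReal_exp, abs_of_pos hx, Complex.real_smul]
  norm_cast
  have h2 : s ^ 2 - 1 = (s - 1) * (s + 1) := by ring
  have h3 : Real.exp (-(x * (s - 1))) = Real.exp x * Real.exp (-x * s) := by
    rw [← Real.exp_add]; ring_nf
  rw [h2, h3, Real.mul_rpow hx.le hs1.le, Real.div_rpow hs2.le two_pos.le,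
    Real.div_rpow hx.le two_pos.le, Real.mul_rpow hs1.le hs2.le]
  ring

theorem besselK_ofReal {ν : ℝ} (hν : 0 ≤ ν) {x : ℝ} (hx : 0 < x) :
    besselK ν x = ((√(Real.pi / 2) * (1 / 2) ^ (ν - 1 / 2) / Real.Gamma (1 / 2 + ν) *
      (x ^ ν * ∫ t in Set.Ioi (1 : ℝ), Real.exp (-x * t) * (t ^ 2 - 1) ^ (ν - 1 / 2)) : ℝ) : ℂ) := by
  have h1 : ((Real.pi : ℂ) / (2 * (x : ℂ))) ^ (1 / 2 : ℂ) =
      ((Real.pi / 2 / x) ^ (1 / 2 : ℝ) : ℝ) := by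
    rw [Complex.ofReal_cpow (by have := Real.pi_pos; positivity)]
    push_cast
    rw [div_div]
  have h2 : Complex.Gamma (1 / 2 + ν) = (Real.Gamma (1 / 2 + ν) : ℝ) := by
    rw [← Complex.Gamma_ofReal]; push_cast; rfl
  rw [besselK_eq_integral_whittakerKernel hν, integral_whittakerKernel_ofReal _ hx, h1, h2,
    ← Complex.ofReal_neg, ← Complex.ofReal_exp]
  norm_cast
  have h3 : x ^ (ν - 1 / 2) * x = x ^ ν * x ^ (1 / 2 : ℝ) := by
    rw [← Real.rpow_add_one hx.ne', ← Real.rpow_add hx]; ring_nf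
  have hx2 : 0 < x ^ (1 / 2 : ℝ) := by positivity
  rw [Real.div_rpow (by have := Real.pi_pos; positivity) hx.le, ← Real.sqrt_eq_rpow (Real.pi / 2),
    div_eq_mul_one_div x 2, Real.mul_rpow hx.le (by norm_num), Real.exp_neg]
  have hΓ : Real.Gamma (1 / 2 + ν) ≠ 0 := (Real.Gamma_pos_of_pos (by positivity)).ne'
  have he := (Real.exp_pos x).ne'
  generalize (∫ t in Set.Ioi (1 : ℝ), Real.exp (-x * t) * (t ^ 2 - 1) ^ (ν - 1 / 2)) = J
  generalize x ^ (ν - 1 / 2) = p at h3 ⊢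
  generalize ((1 : ℝ) / 2) ^ (ν - 1 / 2) = r
  field_simp
  linear_combination (r * J) * h3

theorem besselK_eq_const_mul_coshIntegral {ν : ℝ} (hν : 0 ≤ ν) :
    ∃ c : ℂ, c ≠ 0 ∧ ∀ x : ℂ, 0 < x.re → besselK ν x = c * coshIntegral ν x := by
  obtain ⟨c, hc, h⟩ := integral_exp_neg_mul_cosh_eq hν
  set a := √(Real.pi / 2) * (1 / 2) ^ (ν - 1 / 2) / Real.Gamma (1 / 2 + ν)
  have ha : 0 < a := by
    have := Real.Gamma_pos_of_pos (s := 1 / 2 + ν) (by positivity)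
    have := Real.pi_pos
    positivity
  refine ⟨((a * c : ℝ) : ℂ), by exact_mod_cast mul_ne_zero ha.ne' hc, fun x hx => ?_⟩
  refine eq_of_eq_on_pos_reals (differentiableOn_besselK hν)
    ((differentiableOn_coshIntegral ν).const_mul _) (fun x hx => ?_) hx
  rw [besselK_ofReal hν hx, h x hx, ← mul_assoc, Complex.ofReal_mul (a * c),
    ← integral_complex_ofReal, coshIntegral]
  push_cast
  rfl

/-! ### Transfer to `besselK` and passage to the imaginary axis. -/

theorem norm_besselK_norm_le_of_re_pos (ν : ℝ) {x : ℂ} (hx : 0 < x.re) :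
    0 < ‖besselK ν (‖x‖ : ℝ)‖ ∧ ‖besselK ν (‖x‖ : ℝ)‖ ≤ ‖besselK ν x‖ := by
  obtain ⟨c, hc, h⟩ := besselK_eq_const_mul_coshIntegral (abs_nonneg ν)
  have hn : 0 < ((‖x‖ : ℝ) : ℂ).re := by
    rw [Complex.ofReal_re]; exact norm_pos_iff.2 (ne_zero_of_re_pos hx)
  have hc' := norm_pos_iff.2 hc
  rw [← besselK_abs, ← besselK_abs ν x, h x hx, h _ hn, norm_mul, norm_mul]
  exact ⟨mul_pos hc' (norm_coshIntegral_pos _ hn),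
    mul_le_mul_of_nonneg_left (norm_coshIntegral_norm_le _ hx) hc'.le⟩

theorem norm_besselK_mul_sq_le_of_re_pos (ν : ℝ) {x : ℂ} (hx : 0 < x.re) {τ : ℝ} (hτ : 1 ≤ τ) :
    ‖besselK ν (τ * x)‖ ^ 2 ≤ Real.exp ((1 - τ) * (2 * x.re)) * ‖besselK ν x‖ ^ 2 := by
  obtain ⟨c, hc, h⟩ := besselK_eq_const_mul_coshIntegral (abs_nonneg ν)
  have hτx : 0 < ((τ : ℂ) * x).re := by rw [Complex.re_ofReal_mul]; positivity
  rw [← besselK_abs, ← besselK_abs ν x, h x hx, h _ hτx, norm_mul, norm_mul, mul_pow, mul_pow,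
    mul_left_comm]
  exact mul_le_mul_of_nonneg_left (norm_coshIntegral_mul_le _ hx hτ) (by positivity)

/-- A non-strict inequality between continuous functions passes from the open right half-plane to
its closure. -/
theorem le_of_le_on_re_pos {f g : ℂ → ℝ} {x : ℂ} (hre : 0 ≤ x.re)
    (hf : ContinuousWithinAt f {z | 0 ≤ z.re} x) (hg : ContinuousWithinAt g {z | 0 ≤ z.re} x)
    (h : ∀ z : ℂ, 0 < z.re → f z ≤ g z) : f x ≤ g x := by
  have hsub : {z : ℂ | 0 < z.re} ⊆ {z | 0 ≤ z.re} := 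
    fun z (hz : 0 < z.re) => show 0 ≤ z.re from hz.le
  have : (𝓝[{z : ℂ | 0 < z.re}] x).NeBot := by
    rw [← mem_closure_iff_nhdsWithin_neBot, Complex.closure_setOfPred_lt_re]
    exact hre
  exact le_of_tendsto_of_tendsto (hf.mono hsub) (hg.mono hsub)
    (eventually_nhdsWithin_of_forall h)

theorem norm_besselK_pos (ν : ℝ) {x : ℂ} (hx : x ≠ 0) (hre : 0 ≤ x.re) : 0 < ‖besselK ν x‖ := by
  have hn : ((‖x‖ : ℝ) : ℂ) ≠ 0 := by exact_mod_cast norm_ne_zero_iff.2 hx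
  have hmaps : Set.MapsTo (fun z : ℂ => ((‖z‖ : ℝ) : ℂ)) {z | 0 ≤ z.re} {z | 0 ≤ z.re} :=
    fun z _ => by simp
  have hcont : ContinuousWithinAt (fun z : ℂ => ‖besselK ν (‖z‖ : ℝ)‖) {z | 0 ≤ z.re} x :=
    (ContinuousWithinAt.comp (g := besselK ν) (f := fun z : ℂ => ((‖z‖ : ℝ) : ℂ))
      (continuousWithinAt_besselK ν hn (hmaps hre))
      (Continuous.continuousWithinAt (by fun_prop)) hmaps).norm
  have h := le_of_le_on_re_pos hre hcont (continuousWithinAt_besselK ν hx hre).norm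
    fun z hz => (norm_besselK_norm_le_of_re_pos ν hz).2
  -- Positivity is taken at the real point `‖x‖`, which is interior to the half-plane even if `x` is
  -- on its boundary.
  have hpos := (norm_besselK_norm_le_of_re_pos ν (x := (‖x‖ : ℝ)) (by simpa using hx)).1
  rw [Complex.norm_real, norm_norm] at hpos
  exact hpos.trans_le h

theorem norm_besselK_mul_sq_le (ν : ℝ) {x : ℂ} (hx : x ≠ 0) (hre : 0 ≤ x.re) {τ : ℝ}
    (hτ : 1 ≤ τ) :
    ‖besselK ν (τ * x)‖ ^ 2 ≤ Real.exp ((1 - τ) * (2 * x.re)) * ‖besselK ν x‖ ^ 2 := by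
  have hτ0 : 0 < τ := by linarith
  have hτx : (τ : ℂ) * x ≠ 0 := mul_ne_zero (by exact_mod_cast hτ0.ne') hx
  have hmaps : Set.MapsTo (fun z : ℂ => (τ : ℂ) * z) {z | 0 ≤ z.re} {z | 0 ≤ z.re} := by
    intro z hz
    have : 0 ≤ z.re := hz
    rw [Set.mem_ofPred_eq, Complex.re_ofReal_mul]
    positivity
  refine le_of_le_on_re_pos (f := fun z => ‖besselK ν (τ * z)‖ ^ 2)
    (g := fun z => Real.exp ((1 - τ) * (2 * z.re)) * ‖besselK ν z‖ ^ 2) hre ?_ ?_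
    fun z hz => norm_besselK_mul_sq_le_of_re_pos ν hz hτ
  · exact ((continuousWithinAt_besselK ν hτx (hmaps hre)).comp
      (Continuous.continuousWithinAt (by fun_prop)) hmaps).norm.pow 2
  · exact (Continuous.continuousWithinAt (by fun_prop)).mul
      ((continuousWithinAt_besselK ν hx hre).norm.pow 2)

theorem corollary3p5 (x : ℂ) (hx : x ≠ 0) (harg : |x.arg| ≤ Real.pi / 2) (ν τ : ℝ) (hτ : 1 ≤ τ) :
    besselK ν x ≠ 0 ∧
      ‖besselK ν ((τ : ℂ) * x) / besselK ν x‖ ^ 2 ≤ Real.exp ((1 - τ) * (2 * x.re)) := by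
  have hre : 0 ≤ x.re := Complex.abs_arg_le_pi_div_two_iff.1 harg
  have hpos := norm_besselK_pos ν hx hre
  refine ⟨norm_pos_iff.1 hpos, ?_⟩
  rw [norm_div, div_pow, div_le_iff₀ (by positivity)]
  exact norm_besselK_mul_sq_le ν hx hre hτ
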